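/- Let $H$ be a complex Hilbert space and let $A:\mathfrak D(A)\subset H\to H$ be a strictly positive selfadjoint (possibly unbounded) operator, i.e. $A=A^*$ and $\langle Au,u\rangle\ge c\|u\|^2$ on $\mathfrak D(A)$ for some $c>0$. Let $\theta\in\mathbb R$. Let $H^1=\mathfrak D(A^{1/2})$ with norm $\|A^{1/2}u\|$, and let $\mathcal H=H^1\times H$ with the norm $\|(u,v)\|_{\mathcal H}^2=\|A^{1/2}u\|^2+\|v\|^2$. Consider the operator $$\mathbb A_\theta(u,v)=(v,\,-Au-A^\theta v),\qquad \mathfrak D(\mathbb A_\theta)=\{(u,v)\in\mathcal H:\ v\in H^1,\ Au+A^\theta v\in H\},$$ where, for $u,v\in H$, $Au$ and $A^\theta v$ denote the functionals $w\mapsto\langle Aw,u\rangle$ on $\mathfrak D(A)$ and $w\mapsto\langle A^\theta w,v\rangle$ on $\mathfrak D(A^\theta)$, and $Au+A^\theta v\in H$ means that their sum on $\mathfrak D(A)\cap\mathfrak D(A^\theta)$ is $w\mapsto\langle w,h\rangle$ for some (necessarily unique) $h\in H$, which is then denoted $Au+A^\theta v$. Write $\sigma(\cdot)$ for the spectrum;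 $\sigma(A)\subset(0,\infty)$. For $s\in\sigma(A)$ set $$\xi_s^{\pm}=\begin{cases}-\dfrac{s^\theta}{2}\pm\dfrac{\sqrt{s^{2\theta}-4s}}{2}&\text{if } s^{\theta-1/2}\ge 2,\\[2mm]-\dfrac{s^\theta}{2}\pm i\,\dfrac{\sqrt{4s-s^{2\theta}}}{2}&\text{if } s^{\theta-1/2}<2.\end{cases}$$ Then the following hold. (i) The operator $\mathbb A_\theta:\mathfrak D(\mathbb A_\theta)\to\mathcal H$ is bijective if and only if $\theta\le 1$ or $A$ is a bounded operator. (ii) We have $$\sigma(\mathbb A_\theta)\setminus\{0\}=\begin{cases}\displaystyle\bigcup_{s\in\sigma(A)}\{\xi_s^+,\xi_s^-\}\cup\{-1\}&\text{if }\theta=1\text{ and }A\text{ is unbounded},\\[2mm]\displaystyle\bigcup_{s\in\sigma(A)}\{\xi_s^+,\xi_s^-\}&\text{otherwise.}\end{cases}$$ -/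

import Mathlib

noncomputable section

namespace DampedWave

/-! ### Unbounded operators and their spectra -/

/-- The resolvent set of a (possibly unbounded) operator `T` : the numbers `ξ` such that
`ξ - T : D(T) → E` is a bijection with bounded inverse. -/
def resolventSet {E : Type*} [NormedAddCommGroup E] [NormedSpace ℂ E] (T : E →ₗ.[ℂ] E) : Set ℂ :=
  {ξ | ∃ R : E →L[ℂ] E,
    (∀ y : E, ∃ h : R y ∈ T.domain, ξ • R y - T ⟨R y, h⟩ = y) ∧
    ∀ x : T.domain, R (ξ • (x : E) - T x) = x}

/-- The spectrum of a (possibly unbounded) operator. -/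
def spectrum {E : Type*} [NormedAddCommGroup E] [NormedSpace ℂ E] (T : E →ₗ.[ℂ] E) : Set ℂ :=
  (resolventSet T)ᶜ

/-- `T` is an everywhere defined bounded operator. -/
def IsBoundedOperator {E : Type*} [NormedAddCommGroup E] [NormedSpace ℂ E]
    (T : E →ₗ.[ℂ] E) : Prop :=
  T.domain = ⊤ ∧ ∃ C : ℝ, ∀ x : T.domain, ‖T x‖ ≤ C * ‖(x : E)‖

/-- A strictly positive selfadjoint (in general unbounded) operator on a complex Hilbert space. -/
structure StrictlyPositiveOperator (H : Type*) [NormedAddCommGroup H] [InnerProductSpace ℂ H]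
    [CompleteSpace H] where
  /-- the underlying partially defined linear map -/
  op : H →ₗ.[ℂ] H
  isSelfAdjoint : IsSelfAdjoint op
  strictlyPositive : ∃ c : ℝ, 0 < c ∧
    ∀ x : op.domain, c * ‖(x : H)‖ ^ 2 ≤ (inner ℂ (op x) (x : H)).re

namespace StrictlyPositiveOperator

variable {H : Type*} [NormedAddCommGroup H] [InnerProductSpace ℂ H] [CompleteSpace H]
  (A : StrictlyPositiveOperator H)

/-! ### The bounded inverse -/

theorem exists_bound : ∃ c : ℝ, 0 < c ∧ ∀ x : A.op.domain, c * ‖(x : H)‖ ≤ ‖A.op x‖ := by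
  obtain ⟨c, hc, h⟩ := A.strictlyPositive
  refine ⟨c, hc, fun x => ?_⟩
  have h1 := h x
  have h2 : (inner ℂ (A.op x) (x : H)).re ≤ ‖A.op x‖ * ‖(x : H)‖ :=
    re_inner_le_norm (𝕜 := ℂ) _ _
  rcases (norm_nonneg (x : H)).eq_or_lt with h0 | h0
  · rw [← h0]; simp
  · have : (c * ‖(x : H)‖) * ‖(x : H)‖ ≤ ‖A.op x‖ * ‖(x : H)‖ := by nlinarith
    exact le_of_mul_le_mul_right this h0

theorem symm (x y : A.op.domain) : inner ℂ (A.op x) (y : H) = inner ℂ (x : H) (A.op y) := by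
  have h := LinearPMap.adjoint_isFormalAdjoint (T := A.op) A.isSelfAdjoint.dense_domain
  rw [LinearPMap.isSelfAdjoint_def.mp A.isSelfAdjoint] at h
  exact h x y

theorem mem_of_inner {x y : H} (h : ∀ w : A.op.domain, inner ℂ y (w : H) = inner ℂ x (A.op w)) :
    ∃ hx : x ∈ A.op.domain, A.op ⟨x, hx⟩ = y := by
  have hd := A.isSelfAdjoint.dense_domain
  have e := LinearPMap.isSelfAdjoint_def.mp A.isSelfAdjoint
  have hx' : x ∈ A.op.adjoint.domain := LinearPMap.mem_adjoint_domain_of_exists (T := A.op) x ⟨y, h⟩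
  have hx : x ∈ A.op.domain := by rwa [e] at hx'
  refine ⟨hx, hd.eq_of_inner_left ℂ fun v hv => ?_⟩
  rw [h ⟨v, hv⟩, A.symm ⟨x, hx⟩ ⟨v, hv⟩]

theorem bijective : Function.Bijective A.op.toFun := by
  obtain ⟨c, hc, hb⟩ := A.exists_bound
  have hinj : Function.Injective A.op.toFun := by
    rw [← LinearMap.ker_eq_bot, LinearMap.ker_eq_bot']
    intro x hx
    have h1 := hb x
    have h2 : A.op x = 0 := hx
    rw [h2, norm_zero] at h1
    have h3 : ‖(x : H)‖ = 0 := by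
      have := norm_nonneg (x : H)
      nlinarith
    exact Subtype.ext (norm_eq_zero.mp h3)
  refine ⟨hinj, ?_⟩
  have hclosed : IsClosed (LinearMap.range A.op.toFun : Set H) := by
    refine isClosed_of_closure_subset fun y hy => ?_
    obtain ⟨s, hs, hlim⟩ := mem_closure_iff_seq_limit.mp hy
    choose x hx using hs
    have hcau : CauchySeq fun n => (x n : H) := by
      have hs := hlim.cauchySeq
      rw [Metric.cauchySeq_iff] at hs ⊢
      intro ε hε
      obtain ⟨N, hN⟩ := hs (c * ε) (by positivity)
      refine ⟨N, fun m hm n hn => ?_⟩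
      have h1 := hN m hm n hn
      have h2 := hb (x m - x n)
      rw [dist_eq_norm, ← hx m, ← hx n, ← map_sub] at h1
      have h3 : c * ‖((x m - x n : A.op.domain) : H)‖ < c * ε := lt_of_le_of_lt h2 h1
      rw [dist_eq_norm]
      exact lt_of_mul_lt_mul_left h3 hc.le
    obtain ⟨z, hz⟩ := cauchySeq_tendsto_of_complete hcau
    obtain ⟨hzd, hzA⟩ := A.mem_of_inner (x := z) (y := y) fun w => by
      refine tendsto_nhds_unique (hlim.inner tendsto_const_nhds)
        (Filter.Tendsto.congr (fun n => ?_) (hz.inner tendsto_const_nhds))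
      rw [← hx n]
      exact (A.symm (x n) w).symm
    exact ⟨⟨z, hzd⟩, hzA⟩
  have horth : (LinearMap.range A.op.toFun)ᗮ = ⊥ := by
    rw [Submodule.eq_bot_iff]
    intro y hy
    obtain ⟨hyd, hyA⟩ := A.mem_of_inner (x := y) (y := 0) fun w => by
      rw [inner_zero_left]
      exact (Submodule.inner_left_of_mem_orthogonal (LinearMap.mem_range_self A.op.toFun w) hy).symm
    have : (⟨y, hyd⟩ : A.op.domain) = 0 := hinj (hyA.trans (map_zero A.op.toFun).symm)
    exact congrArg Subtype.val this
  have : CompleteSpace (LinearMap.range A.op.toFun) := hclosed.completeSpace_coe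
  exact LinearMap.range_eq_top.mp (Submodule.orthogonal_eq_bot_iff.mp horth)

/-- The bounded inverse `A⁻¹` of a strictly positive selfadjoint operator `A`. -/
def inv : H →L[ℂ] H :=
  LinearMap.mkContinuousOfExistsBound
    (A.op.domain.subtype ∘ₗ (LinearEquiv.ofBijective A.op.toFun A.bijective).symm.toLinearMap) (by
      obtain ⟨c, hc, hb⟩ := A.exists_bound
      refine ⟨c⁻¹, fun y => ?_⟩
      have h := hb ((LinearEquiv.ofBijective A.op.toFun A.bijective).symm y)
      have e : A.op ((LinearEquiv.ofBijective A.op.toFun A.bijective).symm y) = y :=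
        (LinearEquiv.ofBijective A.op.toFun A.bijective).apply_symm_apply y
      rw [e] at h
      rw [inv_mul_eq_div, le_div_iff₀' hc]
      exact h)

theorem inv_mem (y : H) : A.inv y ∈ A.op.domain :=
  ((LinearEquiv.ofBijective A.op.toFun A.bijective).symm y).2

theorem op_inv (y : H) : A.op ⟨A.inv y, A.inv_mem y⟩ = y :=
  (LinearEquiv.ofBijective A.op.toFun A.bijective).apply_symm_apply y

theorem inv_op (x : A.op.domain) : A.inv (A.op x) = x :=
  congrArg Subtype.val ((LinearEquiv.ofBijective A.op.toFun A.bijective).symm_apply_apply x)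

theorem inv_injective : Function.Injective A.inv := by
  rw [injective_iff_map_eq_zero]
  intro y hy
  have h1 := A.op_inv y
  have h2 : (⟨A.inv y, A.inv_mem y⟩ : A.op.domain) = 0 := Subtype.ext hy
  rw [h2, LinearPMap.map_zero] at h1
  exact h1.symm

theorem inv_nonneg : 0 ≤ A.inv := by
  rw [ContinuousLinearMap.nonneg_iff_isPositive,
    ContinuousLinearMap.isPositive_iff_complex]
  intro y
  have key : inner ℂ (A.inv y) y = inner ℂ (A.op ⟨A.inv y, A.inv_mem y⟩) (A.inv y) := by
    have h := A.symm ⟨A.inv y, A.inv_mem y⟩ ⟨A.inv y, A.inv_mem y⟩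
    rw [h, A.op_inv]
  have hconj : (starRingEnd ℂ) (inner ℂ (A.inv y) y) = inner ℂ (A.inv y) y := by
    rw [inner_conj_symm, key, A.op_inv]
  refine ⟨Complex.conj_eq_iff_re.mp hconj, ?_⟩
  rw [key]
  obtain ⟨c, hc, h⟩ := A.strictlyPositive
  exact le_trans (by positivity) (h ⟨A.inv y, A.inv_mem y⟩)

/-! ### Fractional powers -/

theorem inv_rpow_add {s t : ℝ} (hs : 0 ≤ s) (ht : 0 ≤ t) :
    A.inv ^ (s + t) = A.inv ^ s * A.inv ^ t := by
  rw [CFC.rpow_def, CFC.rpow_def, CFC.rpow_def, ← cfc_mul _ _ A.inv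
    (NNReal.continuous_rpow_const hs).continuousOn (NNReal.continuous_rpow_const ht).continuousOn]
  exact cfc_congr fun x _ => NNReal.rpow_add_of_nonneg x hs ht

theorem inv_rpow_injective {t : ℝ} (ht : 0 ≤ t) : Function.Injective (A.inv ^ t) := by
  obtain ⟨n, hn⟩ := exists_nat_ge t
  have h1 : A.inv ^ n = A.inv ^ ((n : ℝ) - t) * A.inv ^ t := by
    rw [← A.inv_rpow_add (sub_nonneg.mpr hn) ht, sub_add_cancel,
      CFC.rpow_natCast A.inv n A.inv_nonneg]
  have h2 : Function.Injective (A.inv ^ n) := by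
    have h3 : ⇑(A.inv ^ n) = A.inv^[n] := funext fun x => by rw [FunLike.coe_pow_eq_iterate]
    rw [h3]
    exact A.inv_injective.iterate n
  rw [h1] at h2
  exact Function.Injective.of_comp (f := (A.inv ^ ((n : ℝ) - t) : H →L[ℂ] H)) h2

/-- The fractional power `A ^ θ`, `θ : ℝ`: for `t ≥ 0` the operator `A ^ (-t)` is the bounded
operator `(A⁻¹) ^ t`, given by the continuous functional calculus of `A⁻¹`; for `t > 0` the
operator `A ^ t` is the inverse of the injective operator `A ^ (-t)`, with domain the range of
`A ^ (-t)`. -/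
def fracPow (θ : ℝ) : H →ₗ.[ℂ] H :=
  if 0 < θ then ((A.inv ^ θ : H →L[ℂ] H).toLinearMap.toPMap ⊤).inverse
  else (A.inv ^ (-θ) : H →L[ℂ] H).toLinearMap.toPMap ⊤

theorem fracPow_mem_graph_iff {θ : ℝ} (hθ : 0 < θ) (x y : H) :
    (x, y) ∈ (A.fracPow θ).graph ↔ (A.inv ^ θ) y = x := by
  have hk : LinearMap.ker ((A.inv ^ θ : H →L[ℂ] H).toLinearMap.toPMap ⊤).toFun = ⊥ := by
    rw [LinearMap.ker_eq_bot']
    intro m hm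
    have : (A.inv ^ θ) (m : H) = (A.inv ^ θ) 0 := by rw [map_zero]; exact hm
    exact Subtype.ext (A.inv_rpow_injective hθ.le this)
  rw [fracPow, if_pos hθ, LinearPMap.inverse_graph hk]
  simp [LinearPMap.mem_graph_iff]

theorem fracPow_rpow {θ : ℝ} (hθ : 0 < θ) (y : H) :
    ∃ h : (A.inv ^ θ) y ∈ (A.fracPow θ).domain, A.fracPow θ ⟨(A.inv ^ θ) y, h⟩ = y := by
  have := (A.fracPow_mem_graph_iff hθ _ y).mpr rfl
  obtain ⟨z, h1, h2⟩ := (LinearPMap.mem_graph_iff _).mp this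
  dsimp only at h1 h2
  have hz : (A.inv ^ θ) y ∈ (A.fracPow θ).domain := by rw [← h1]; exact z.2
  refine ⟨hz, ?_⟩
  refine Eq.trans ?_ h2
  congr 1
  exact Subtype.ext h1.symm

theorem rpow_fracPow {θ : ℝ} (hθ : 0 < θ) (x : (A.fracPow θ).domain) :
    (A.inv ^ θ) (A.fracPow θ x) = x :=
  (A.fracPow_mem_graph_iff hθ _ _).mp (LinearPMap.mem_graph _ x)

/-- The first power is the operator itself. -/
theorem fracPow_one : A.fracPow 1 = A.op := by
  refine LinearPMap.eq_of_eq_graph (Submodule.ext fun ⟨x, y⟩ => ?_)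
  rw [A.fracPow_mem_graph_iff one_pos, CFC.rpow_one A.inv A.inv_nonneg, LinearPMap.mem_graph_iff]
  constructor
  · rintro rfl
    exact ⟨⟨A.inv y, A.inv_mem y⟩, rfl, A.op_inv y⟩
  · rintro ⟨z, h1, h2⟩
    dsimp only at h1 h2
    rw [← h1, ← h2]
    exact A.inv_op z

/-! ### The phase space -/

/-- The space `H¹ = D(A ^ (1/2))`, to be normed by `‖A ^ (1/2) u‖`. -/
def EnergySpace : Type _ := (A.fracPow (1 / 2)).domain

instance : AddCommGroup A.EnergySpace := inferInstanceAs (AddCommGroup (A.fracPow (1 / 2)).domain)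

instance : Module ℂ A.EnergySpace := inferInstanceAs (Module ℂ (A.fracPow (1 / 2)).domain)

/-- The inclusion `H¹ ⊆ H`. -/
def incl : A.EnergySpace →ₗ[ℂ] H := (A.fracPow (1 / 2)).domain.subtype

theorem incl_injective : Function.Injective A.incl := Subtype.val_injective

/-- The operator `A ^ (1/2)` on `H¹`. -/
def sqrtOp : A.EnergySpace →ₗ[ℂ] H := (A.fracPow (1 / 2)).toFun

theorem sqrtOp_eq_zero {u : A.EnergySpace} (h : A.sqrtOp u = 0) : u = 0 := by
  have h1 := A.rpow_fracPow (θ := 1 / 2) (by norm_num) u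
  have h2 : A.fracPow (1 / 2) u = 0 := h
  rw [h2, map_zero] at h1
  exact Subtype.ext h1.symm

/-- The inner product `⟨u, v⟩₁ = ⟨A ^ (1/2) u, A ^ (1/2) v⟩` on `H¹`. -/
@[reducible] def energyCore : InnerProductSpace.Core ℂ A.EnergySpace where
  inner u v := inner ℂ (A.sqrtOp u) (A.sqrtOp v)
  conj_inner_symm u v := inner_conj_symm _ _
  re_inner_nonneg u := inner_self_nonneg
  add_left u v w := by rw [map_add, inner_add_left]
  smul_left u v r := by rw [map_smul, inner_smul_left]
  definite u h := A.sqrtOp_eq_zero (inner_self_eq_zero.mp h)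

instance : NormedAddCommGroup A.EnergySpace := A.energyCore.toNormedAddCommGroup

instance : InnerProductSpace ℂ A.EnergySpace := InnerProductSpace.ofCore A.energyCore.toCore

/-- The phase space `H¹ × H` with the norm `‖(u, v)‖² = ‖A ^ (1/2) u‖² + ‖v‖²`. -/
abbrev PhaseSpace : Type _ := WithLp 2 (A.EnergySpace × H)

/-! ### The generator -/

/-- `A u + A ^ θ v = h`, where `A u` and `A ^ θ v` are understood as the functionals
`w ↦ ⟨A w, u⟩` on `D(A)` and `w ↦ ⟨A ^ θ w, v⟩` on `D(A ^ θ)`, whose sum acts on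
`D(A) ∩ D(A ^ θ)`, and where `h : H` is understood as the functional `w ↦ ⟨w, h⟩`. -/
def WeakSum (θ : ℝ) (u v h : H) : Prop :=
  ∀ (w : H) (h₁ : w ∈ A.op.domain) (h₂ : w ∈ (A.fracPow θ).domain),
    inner ℂ (A.op ⟨w, h₁⟩) u + inner ℂ (A.fracPow θ ⟨w, h₂⟩) v = inner ℂ w h

variable {A}

theorem WeakSum.add {θ : ℝ} {u v h u' v' h' : H} (H₁ : A.WeakSum θ u v h)
    (H₂ : A.WeakSum θ u' v' h') : A.WeakSum θ (u + u') (v + v') (h + h') := by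
  intro w h₁ h₂
  simp only [inner_add_right, ← H₁ w h₁ h₂, ← H₂ w h₁ h₂]
  ring

theorem WeakSum.smul {θ : ℝ} {u v h : H} (c : ℂ) (H₁ : A.WeakSum θ u v h) :
    A.WeakSum θ (c • u) (c • v) (c • h) := by
  intro w h₁ h₂
  simp only [inner_smul_right, ← H₁ w h₁ h₂]
  ring

theorem WeakSum.unique {θ : ℝ} {u v h h' : H} (H₁ : A.WeakSum θ u v h)
    (H₂ : A.WeakSum θ u v h') : h = h' := by
  set t : ℝ := max θ 0 with ht
  have ht0 : 0 ≤ t := le_max_right _ _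
  have hs : IsSelfAdjoint (A.inv ^ (1 + t)) := IsSelfAdjoint.of_nonneg CFC.rpow_nonneg
  refine A.inv_rpow_injective (t := 1 + t) (by positivity) (ext_inner_left ℂ fun y => ?_)
  have e1 : (A.inv ^ (1 + t)) y = A.inv ((A.inv ^ t) y) := by
    rw [A.inv_rpow_add zero_le_one ht0, CFC.rpow_one A.inv A.inv_nonneg]
    rfl
  have m1 : (A.inv ^ (1 + t)) y ∈ A.op.domain := by rw [e1]; exact A.inv_mem _
  have m2 : (A.inv ^ (1 + t)) y ∈ (A.fracPow θ).domain := by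
    rcases lt_or_ge 0 θ with h0 | h0
    · have : t = θ := max_eq_left h0.le
      rw [add_comm, A.inv_rpow_add ht0 zero_le_one, this]
      exact (A.fracPow_rpow h0 _).1
    · rw [fracPow, if_neg (not_lt.mpr h0)]
      exact Submodule.mem_top
  rw [← ContinuousLinearMap.adjoint_inner_left, ← ContinuousLinearMap.adjoint_inner_left,
    hs.adjoint_eq, ← H₁ _ m1 m2, ← H₂ _ m1 m2]

variable (A)

/-- The operator `(u, v) ↦ (v, -(A u + A ^ θ v))` on the phase space `H¹ × H`, with domain the
pairs `(u, v)` such that `v ∈ H¹` and `A u + A ^ θ v ∈ H`. -/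
def generator (θ : ℝ) : A.PhaseSpace →ₗ.[ℂ] A.PhaseSpace where
  domain :=
    { carrier := {z | (∃ v₁ : A.EnergySpace, A.incl v₁ = z.snd) ∧
        ∃ h : H, A.WeakSum θ (A.incl z.fst) z.snd h}
      zero_mem' := ⟨⟨0, by simp⟩, 0, fun w h₁ h₂ => by simp⟩
      add_mem' := by
        rintro z z' ⟨⟨v, hv⟩, h, hh⟩ ⟨⟨v', hv'⟩, h', hh'⟩
        refine ⟨⟨v + v', by simp [hv, hv']⟩, h + h', ?_⟩
        simpa using hh.add hh'
      smul_mem' := by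
        rintro c z ⟨⟨v, hv⟩, h, hh⟩
        refine ⟨⟨c • v, by simp [hv]⟩, c • h, ?_⟩
        simpa using hh.smul c }
  toFun :=
    { toFun := fun z => WithLp.toLp 2 (z.2.1.choose, -z.2.2.choose)
      map_add' := by
        intro z z'
        have e1 : (z + z').2.1.choose = z.2.1.choose + z'.2.1.choose := by
          apply A.incl_injective
          rw [map_add, (z + z').2.1.choose_spec, z.2.1.choose_spec, z'.2.1.choose_spec]
          simp
        have e2 : (z + z').2.2.choose = z.2.2.choose + z'.2.2.choose := by
          refine (z + z').2.2.choose_spec.unique ?_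
          simpa using z.2.2.choose_spec.add z'.2.2.choose_spec
        rw [e1, e2, neg_add, ← WithLp.toLp_add, Prod.mk_add_mk]
      map_smul' := by
        intro c z
        have e1 : (c • z).2.1.choose = c • z.2.1.choose := by
          apply A.incl_injective
          rw [map_smul, (c • z).2.1.choose_spec, z.2.1.choose_spec]
          simp
        have e2 : (c • z).2.2.choose = c • z.2.2.choose := by
          refine (c • z).2.2.choose_spec.unique ?_
          simpa using z.2.2.choose_spec.smul c
        rw [e1, e2, ← smul_neg, RingHom.id_apply, ← WithLp.toLp_smul, Prod.smul_mk] }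

theorem generator_fst (θ : ℝ) (z : (A.generator θ).domain) :
    A.incl (A.generator θ z).fst = (z : A.PhaseSpace).snd :=
  z.2.1.choose_spec

theorem generator_snd (θ : ℝ) (z : (A.generator θ).domain) :
    A.WeakSum θ (A.incl (z : A.PhaseSpace).fst) (z : A.PhaseSpace).snd
      (-(A.generator θ z).snd) := by
  have h : -(A.generator θ z).snd = z.2.2.choose := neg_neg _
  rw [h]
  exact z.2.2.choose_spec

end StrictlyPositiveOperator

/-- The number `ξ_s⁺`. -/
def xiPlus (θ s : ℝ) : ℂ :=
  if 2 ≤ s ^ (θ - 1 / 2) then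
    ((-(s ^ θ / 2) + √(s ^ (2 * θ) - 4 * s) / 2 : ℝ) : ℂ)
  else
    ((-(s ^ θ / 2) : ℝ) : ℂ) + Complex.I * ((√(4 * s - s ^ (2 * θ)) / 2 : ℝ) : ℂ)

/-- The number `ξ_s⁻`. -/
def xiMinus (θ s : ℝ) : ℂ :=
  if 2 ≤ s ^ (θ - 1 / 2) then
    ((-(s ^ θ / 2) - √(s ^ (2 * θ) - 4 * s) / 2 : ℝ) : ℂ)
  else
    ((-(s ^ θ / 2) : ℝ) : ℂ) - Complex.I * ((√(4 * s - s ^ (2 * θ)) / 2 : ℝ) : ℂ)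

end DampedWave

end

noncomputable section

namespace DampedWave

theorem bijective_of_mem_resolventSet {E : Type*} [NormedAddCommGroup E] [NormedSpace ℂ E]
    {T : E →ₗ.[ℂ] E} {ξ : ℂ} (h : ξ ∈ resolventSet T) :
    Function.Bijective fun z : T.domain => ξ • (z : E) - T z := by
  obtain ⟨R, h₁, h₂⟩ := h
  refine ⟨fun x y hxy => Subtype.ext ?_, fun y => ⟨⟨R y, (h₁ y).1⟩, (h₁ y).2⟩⟩
  rw [← h₂ x, ← h₂ y]
  exact congrArg R hxy

namespace StrictlyPositiveOperator

variable {H : Type*} [NormedAddCommGroup H] [InnerProductSpace ℂ H] [CompleteSpace H]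
  (A : StrictlyPositiveOperator H)

/-! ### Powers of the bounded inverse -/

theorem inv_rpow_apply_add {s t : ℝ} (hs : 0 ≤ s) (ht : 0 ≤ t) (x : H) :
    (A.inv ^ (s + t)) x = (A.inv ^ s) ((A.inv ^ t) x) := by
  rw [A.inv_rpow_add hs ht]
  rfl

theorem inv_rpow_apply_comm {s t : ℝ} (hs : 0 ≤ s) (ht : 0 ≤ t) (x : H) :
    (A.inv ^ s) ((A.inv ^ t) x) = (A.inv ^ t) ((A.inv ^ s) x) := by
  rw [← A.inv_rpow_apply_add hs ht, ← A.inv_rpow_apply_add ht hs, add_comm]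

theorem isSelfAdjoint_inv_rpow (t : ℝ) : IsSelfAdjoint (A.inv ^ t) :=
  IsSelfAdjoint.of_nonneg CFC.rpow_nonneg

theorem inner_inv_rpow_left (t : ℝ) (x y : H) :
    inner ℂ ((A.inv ^ t) x) y = inner ℂ x ((A.inv ^ t) y) := by
  rw [← ContinuousLinearMap.adjoint_inner_right, (A.isSelfAdjoint_inv_rpow t).adjoint_eq]

theorem fracPow_inv_rpow {θ a : ℝ} (ha : 0 ≤ a) (hθ : θ ≤ a) (y : H) :
    ∃ h : (A.inv ^ a) y ∈ (A.fracPow θ).domain,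
      A.fracPow θ ⟨(A.inv ^ a) y, h⟩ = (A.inv ^ (a - θ)) y := by
  have hg : ((A.inv ^ a) y, (A.inv ^ (a - θ)) y) ∈ (A.fracPow θ).graph := by
    rcases lt_or_ge 0 θ with h0 | h0
    · rw [A.fracPow_mem_graph_iff h0, ← A.inv_rpow_apply_add h0.le (sub_nonneg.mpr hθ),
        add_sub_cancel]
    · rw [fracPow, if_neg (not_lt.mpr h0), sub_eq_neg_add,
        A.inv_rpow_apply_add (neg_nonneg.mpr h0) ha]
      simp [LinearPMap.mem_graph_iff]
  obtain ⟨z, h₁, h₂⟩ := (LinearPMap.mem_graph_iff _).mp hg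
  dsimp only at h₁ h₂
  have hm : (A.inv ^ a) y ∈ (A.fracPow θ).domain := h₁ ▸ z.2
  refine ⟨hm, Eq.trans ?_ h₂⟩
  congr 1
  exact Subtype.ext h₁.symm

theorem op_inv_rpow {a : ℝ} (ha : 1 ≤ a) (y : H) :
    ∃ h : (A.inv ^ a) y ∈ A.op.domain, A.op ⟨(A.inv ^ a) y, h⟩ = (A.inv ^ (a - 1)) y := by
  have := A.fracPow_inv_rpow (zero_le_one.trans ha) ha y
  rwa [A.fracPow_one] at this

/-! ### The phase space in coordinates -/

theorem incl_eq (u : A.EnergySpace) : A.incl u = (A.inv ^ (1 / 2 : ℝ)) (A.sqrtOp u) :=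
  (A.rpow_fracPow (θ := 1 / 2) (by norm_num) u).symm

theorem sqrtOp_bijective : Function.Bijective A.sqrtOp := by
  refine ⟨(injective_iff_map_eq_zero _).mpr fun u => A.sqrtOp_eq_zero, fun p => ?_⟩
  obtain ⟨h, e⟩ := A.fracPow_rpow (θ := 1 / 2) (by norm_num) p
  exact ⟨⟨_, h⟩, e⟩

theorem norm_sqrtOp (u : A.EnergySpace) : ‖A.sqrtOp u‖ = ‖u‖ := by
  rw [@norm_eq_sqrt_re_inner ℂ, @norm_eq_sqrt_re_inner ℂ]
  rfl

/-- The isometry `A ^ (1/2)` of `H¹` onto `H`. -/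
def sqrtEquiv : A.EnergySpace ≃ₗᵢ[ℂ] H where
  toLinearEquiv := LinearEquiv.ofBijective A.sqrtOp A.sqrtOp_bijective
  norm_map' := A.norm_sqrtOp

/-! ### The generator through bounded operators -/

theorem weakSum_iff {θ : ℝ} {u v h : H} : A.WeakSum θ u v h ↔
    (A.inv ^ (max θ 1 - 1)) u + (A.inv ^ (max θ 1 - θ)) v = (A.inv ^ max θ 1) h := by
  have h0 : (0 : ℝ) ≤ max θ 1 := zero_le_one.trans (le_max_right _ _)
  constructor
  · intro H₁
    refine ext_inner_left ℂ fun y => ?_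
    obtain ⟨m₁, e₁⟩ := A.op_inv_rpow (le_max_right θ 1) y
    obtain ⟨m₂, e₂⟩ := A.fracPow_inv_rpow h0 (le_max_left θ 1) y
    have := H₁ _ m₁ m₂
    rw [e₁, e₂] at this
    simpa only [inner_add_right, A.inner_inv_rpow_left] using this
  · intro e w h₁ h₂
    obtain ⟨y, rfl⟩ : ∃ y, (A.inv ^ max θ 1) y = w := by
      rcases le_total θ 1 with h | h
      · rw [max_eq_right h]
        refine ⟨A.fracPow 1 ⟨w, ?_⟩, A.rpow_fracPow one_pos ⟨w, ?_⟩⟩ <;> rwa [A.fracPow_one]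
      · rw [max_eq_left h]
        exact ⟨_, A.rpow_fracPow (by linarith) ⟨w, h₂⟩⟩
    obtain ⟨m₁, e₁⟩ := A.op_inv_rpow (le_max_right θ 1) y
    obtain ⟨m₂, e₂⟩ := A.fracPow_inv_rpow h0 (le_max_left θ 1) y
    rw [e₁, e₂, A.inner_inv_rpow_left, A.inner_inv_rpow_left, A.inner_inv_rpow_left, ← e,
      inner_add_right]

theorem generator_eq_iff (θ : ℝ) (z z' : A.PhaseSpace) :
    (∃ h : z ∈ (A.generator θ).domain, A.generator θ ⟨z, h⟩ = z') ↔
      A.incl z'.fst = z.snd ∧ A.WeakSum θ (A.incl z.fst) z.snd (-z'.snd) := by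
  constructor
  · rintro ⟨h, rfl⟩
    exact ⟨A.generator_fst θ ⟨z, h⟩, A.generator_snd θ ⟨z, h⟩⟩
  · rintro ⟨h₁, h₂⟩
    have h : z ∈ (A.generator θ).domain := ⟨⟨_, h₁⟩, _, h₂⟩
    refine ⟨h, WithLp.ofLp_injective 2 (Prod.ext ?_ ?_)⟩
    · exact A.incl_injective ((A.generator_fst θ ⟨z, h⟩).trans h₁.symm)
    · exact neg_injective ((A.generator_snd θ ⟨z, h⟩).unique h₂)

/-- The quadratic pencil of bounded operators
`A ^ (-a) * (A + ξ • A ^ θ + ξ ^ 2)` with `a = max θ 1`. -/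
def pencil (θ : ℝ) (ξ : ℂ) : H →L[ℂ] H :=
  A.inv ^ (max θ 1 - 1) + ξ • A.inv ^ (max θ 1 - θ) + ξ ^ 2 • A.inv ^ max θ 1

theorem pencil_apply (θ : ℝ) (ξ : ℂ) (p : H) : A.pencil θ ξ p = (A.inv ^ (max θ 1 - 1)) p +
    ξ • (A.inv ^ (max θ 1 - θ)) p + ξ ^ 2 • (A.inv ^ max θ 1) p := rfl

/-- The right hand side of the equation for the pencil to which the resolvent equation of the
generator is equivalent. -/
def pencilData (θ : ℝ) (ξ : ℂ) : H × H →L[ℂ] H :=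
  (A.inv ^ (max θ 1 - θ) + ξ • A.inv ^ max θ 1) ∘L ContinuousLinearMap.fst ℂ H H +
    (A.inv ^ (max θ 1 - 1 / 2)) ∘L ContinuousLinearMap.snd ℂ H H

theorem pencilData_apply (θ : ℝ) (ξ : ℂ) (f g : H) : A.pencilData θ ξ (f, g) =
    (A.inv ^ (max θ 1 - θ)) f + ξ • (A.inv ^ max θ 1) f + (A.inv ^ (max θ 1 - 1 / 2)) g := rfl

theorem resolvent_eq_iff (θ : ℝ) (ξ : ℂ) (z y : A.PhaseSpace) :
    (∃ h : z ∈ (A.generator θ).domain, ξ • z - A.generator θ ⟨z, h⟩ = y) ↔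
      z.snd = (A.inv ^ (1 / 2 : ℝ)) (ξ • A.sqrtOp z.fst - A.sqrtOp y.fst) ∧
      A.pencil θ ξ (A.sqrtOp z.fst) = A.pencilData θ ξ (A.sqrtOp y.fst, y.snd) := by
  have key : (∃ h : z ∈ (A.generator θ).domain, ξ • z - A.generator θ ⟨z, h⟩ = y) ↔
      ∃ h : z ∈ (A.generator θ).domain, A.generator θ ⟨z, h⟩ = ξ • z - y :=
    exists_congr fun h => ⟨fun e => by rw [← e]; abel, fun e => by rw [e]; abel⟩
  rw [key, A.generator_eq_iff, A.weakSum_iff]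
  have e1 : A.incl (ξ • z - y).fst =
      (A.inv ^ (1 / 2 : ℝ)) (ξ • A.sqrtOp z.fst - A.sqrtOp y.fst) := by
    rw [A.incl_eq, ← map_smul, ← map_sub]
    rfl
  have e2 : -(ξ • z - y).snd = y.snd - ξ • z.snd := neg_sub _ _
  rw [e1, e2, A.incl_eq, eq_comm]
  refine and_congr_right fun hv => ?_
  rw [hv]
  generalize A.sqrtOp z.fst = p
  generalize A.sqrtOp y.fst = f
  generalize y.snd = g
  have h1 : (0 : ℝ) ≤ max θ 1 - 1 := sub_nonneg.mpr (le_max_right _ _)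
  have hθ : (0 : ℝ) ≤ max θ 1 - θ := sub_nonneg.mpr (le_max_left _ _)
  have ha : (0 : ℝ) ≤ max θ 1 := by linarith
  have hh : (0 : ℝ) ≤ max θ 1 - 1 / 2 := by linarith
  have h2 : (0 : ℝ) ≤ 1 / 2 := by norm_num
  have e3 : (A.inv ^ max θ 1) g = (A.inv ^ (1 / 2 : ℝ)) ((A.inv ^ (max θ 1 - 1 / 2)) g) := by
    rw [← A.inv_rpow_apply_add h2 hh, add_sub_cancel]
  rw [map_sub (A.inv ^ max θ 1), map_smul, e3, A.inv_rpow_apply_comm h1 h2,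
    A.inv_rpow_apply_comm hθ h2, A.inv_rpow_apply_comm ha h2, ← map_smul (A.inv ^ (1 / 2 : ℝ)),
    ← map_add, ← map_sub (A.inv ^ (1 / 2 : ℝ)), (A.inv_rpow_injective h2).eq_iff,
    A.pencil_apply, A.pencilData_apply]
  simp only [map_sub, map_smul, smul_sub, smul_smul, ← sq]
  rw [← sub_eq_zero, ← sub_eq_zero (b := _ + (A.inv ^ (max θ 1 - 1 / 2)) g)]
  refine Eq.congr_left ?_
  abel

theorem mem_resolventSet_of_isUnit {θ : ℝ} {ξ : ℂ} (h : IsUnit (A.pencil θ ξ)) :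
    ξ ∈ resolventSet (A.generator θ) := by
  obtain ⟨U, hU⟩ := h
  have hl (x : H) : (↑U⁻¹ : H →L[ℂ] H) (A.pencil θ ξ x) = x := by
    rw [← hU]; exact congrArg (fun T : H →L[ℂ] H => T x) U.inv_mul
  have hr (x : H) : A.pencil θ ξ ((↑U⁻¹ : H →L[ℂ] H) x) = x := by
    rw [← hU]; exact congrArg (fun T : H →L[ℂ] H => T x) U.mul_inv
  let F : A.PhaseSpace →L[ℂ] H :=
    (A.sqrtEquiv : A.EnergySpace →L[ℂ] H) ∘L WithLp.fstL 2 ℂ A.EnergySpace H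
  let S : A.PhaseSpace →L[ℂ] H :=
    (↑U⁻¹ : H →L[ℂ] H) ∘L A.pencilData θ ξ ∘L F.prod (WithLp.sndL 2 ℂ A.EnergySpace H)
  let R : A.PhaseSpace →L[ℂ] A.PhaseSpace :=
    ((WithLp.prodContinuousLinearEquiv 2 ℂ A.EnergySpace H).symm :
      A.EnergySpace × H →L[ℂ] A.PhaseSpace) ∘L
    ((A.sqrtEquiv.symm : H →L[ℂ] A.EnergySpace) ∘L S).prod
      ((A.inv ^ (1 / 2 : ℝ)) ∘L (ξ • S - F))
  have hS (y : A.PhaseSpace) :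
      A.pencil θ ξ (S y) = A.pencilData θ ξ (A.sqrtOp y.fst, y.snd) := hr _
  have hR1 (y : A.PhaseSpace) : A.sqrtOp (R y).fst = S y := A.sqrtEquiv.apply_symm_apply (S y)
  have hR2 (y : A.PhaseSpace) :
      (R y).snd = (A.inv ^ (1 / 2 : ℝ)) (ξ • S y - A.sqrtOp y.fst) := rfl
  refine ⟨R, fun y => (A.resolvent_eq_iff θ ξ _ y).mpr ?_, fun z => ?_⟩
  · rw [hR1]
    exact ⟨hR2 y, hS y⟩
  · obtain ⟨h₁, h₂⟩ := (A.resolvent_eq_iff θ ξ z _).mp ⟨z.2, rfl⟩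
    set y : A.PhaseSpace := ξ • (z : A.PhaseSpace) - A.generator θ z
    have e : S y = A.sqrtOp (z : A.PhaseSpace).fst := by
      rw [← hl (S y), hS, ← h₂, hl]
    refine WithLp.ofLp_injective 2 (Prod.ext (A.sqrtOp_bijective.1 ?_) ?_)
    · exact (hR1 y).trans e
    · exact (hR2 y).trans (by rw [e]; exact h₁.symm)

theorem isUnit_pencil_of_bijective {θ : ℝ} {ξ : ℂ}
    (h : Function.Bijective fun z : (A.generator θ).domain =>
      ξ • (z : A.PhaseSpace) - A.generator θ z) : IsUnit (A.pencil θ ξ) := by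
  have solve (f g : H) : ∃ p, A.pencil θ ξ p = A.pencilData θ ξ (f, g) := by
    obtain ⟨u, rfl⟩ := A.sqrtOp_bijective.2 f
    obtain ⟨z, hz⟩ := h.2 (WithLp.toLp 2 (u, g))
    exact ⟨_, ((A.resolvent_eq_iff θ ξ z _).mp ⟨z.2, hz⟩).2⟩
  rw [ContinuousLinearMap.isUnit_iff_bijective]
  refine ⟨(injective_iff_map_eq_zero _).mpr fun p hp => ?_, ?_⟩
  · obtain ⟨u, rfl⟩ := A.sqrtOp_bijective.2 p
    obtain ⟨m, e⟩ := (A.resolvent_eq_iff θ ξ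
      (WithLp.toLp 2 (u, (A.inv ^ (1 / 2 : ℝ)) (ξ • A.sqrtOp u))) 0).mpr
        ⟨by simp, hp.trans (by simp [pencilData_apply])⟩
    have h0 := @h.1 ⟨_, m⟩ 0 (by simpa using e)
    have h1 : u = 0 := congrArg WithLp.fst (congrArg Subtype.val h0)
    rw [h1, map_zero]
  · have ha : (0 : ℝ) ≤ max θ 1 - 1 / 2 := by linarith [le_max_right θ 1]
    have r1 (x : H) : A.pencilData θ ξ (0, x) ∈ LinearMap.range (A.pencil θ ξ).toLinearMap :=
      solve 0 x
    have r2 (x : H) : (A.inv ^ max θ 1) x ∈ LinearMap.range (A.pencil θ ξ).toLinearMap := by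
      have := r1 ((A.inv ^ (1 / 2 : ℝ)) x)
      rwa [pencilData_apply, map_zero, map_zero, smul_zero, zero_add, zero_add,
        ← A.inv_rpow_apply_add ha (by norm_num), sub_add_cancel] at this
    have r3 (x : H) : (A.inv ^ (max θ 1 - θ)) x ∈
        LinearMap.range (A.pencil θ ξ).toLinearMap := by
      have h1 : A.pencilData θ ξ (x, 0) ∈ LinearMap.range (A.pencil θ ξ).toLinearMap := solve x 0
      rw [pencilData_apply, map_zero, add_zero] at h1
      have := Submodule.sub_mem _ h1 (Submodule.smul_mem _ ξ (r2 x))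
      rwa [add_sub_cancel_right] at this
    have r4 (x : H) : (A.inv ^ (max θ 1 - 1)) x ∈
        LinearMap.range (A.pencil θ ξ).toLinearMap := by
      have h1 : A.pencil θ ξ x ∈ LinearMap.range (A.pencil θ ξ).toLinearMap := ⟨x, rfl⟩
      rw [pencil_apply] at h1
      have h2 := Submodule.sub_mem _ h1 (Submodule.smul_mem _ (ξ ^ 2) (r2 x))
      rw [add_sub_cancel_right] at h2
      have h3 := Submodule.sub_mem _ h2 (Submodule.smul_mem _ ξ (r3 x))
      rwa [add_sub_cancel_right] at h3
    intro x
    rcases le_total θ 1 with h | h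
    · have := r4 x
      rwa [max_eq_right h, sub_self, CFC.rpow_zero A.inv A.inv_nonneg] at this
    · have := r3 x
      rwa [max_eq_left h, sub_self, CFC.rpow_zero A.inv A.inv_nonneg] at this

theorem mem_resolventSet_generator_iff {θ : ℝ} {ξ : ℂ} :
    ξ ∈ resolventSet (A.generator θ) ↔ IsUnit (A.pencil θ ξ) :=
  ⟨fun h => A.isUnit_pencil_of_bijective (bijective_of_mem_resolventSet h),
    A.mem_resolventSet_of_isUnit⟩

theorem generator_bijective_iff {θ : ℝ} :
    Function.Bijective (fun z : (A.generator θ).domain => A.generator θ z) ↔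
      IsUnit (A.pencil θ 0) := by
  have e : (fun z : (A.generator θ).domain => (0 : ℂ) • (z : A.PhaseSpace) - A.generator θ z) =
      Neg.neg ∘ fun z : (A.generator θ).domain => A.generator θ z := by
    funext z
    simp
  have h : Function.Bijective (Neg.neg : A.PhaseSpace → A.PhaseSpace) := neg_involutive.bijective
  rw [← h.of_comp_iff', ← e]
  exact ⟨A.isUnit_pencil_of_bijective,
    fun hu => bijective_of_mem_resolventSet (A.mem_resolventSet_of_isUnit hu)⟩

/-! ### Spectra through the functional calculus -/

theorem inv_rpow_eq_cfc (t : ℝ) :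
    A.inv ^ t = cfc (fun z : ℂ => ((z.re.toNNReal ^ t : NNReal) : ℂ)) A.inv := by
  rw [CFC.rpow_def, cfc_nnreal_eq_real _ A.inv A.inv_nonneg,
    cfc_real_eq_complex _ (IsSelfAdjoint.of_nonneg A.inv_nonneg)]

theorem eq_re_of_mem_spectrum {z : ℂ} (hz : z ∈ _root_.spectrum ℂ A.inv) :
    z = z.re ∧ 0 ≤ z.re := by
  have e := (IsSelfAdjoint.of_nonneg A.inv_nonneg).mem_spectrum_eq_re hz
  refine ⟨e, spectrum_nonneg_of_nonneg (𝕜 := ℝ) A.inv_nonneg ?_⟩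
  rw [e] at hz
  exact spectrum.of_algebraMap_mem ℂ hz

theorem isUnit_pencil_iff {θ : ℝ} {ξ : ℂ} : IsUnit (A.pencil θ ξ) ↔
    ∀ x : ℝ, 0 ≤ x → (x : ℂ) ∈ _root_.spectrum ℂ A.inv →
      ((x ^ (max θ 1 - 1) : ℝ) : ℂ) + ξ * (x ^ (max θ 1 - θ) : ℝ) + ξ ^ 2 * (x ^ max θ 1 : ℝ)
        ≠ 0 := by
  have hc {t : ℝ} (ht : 0 ≤ t) : Continuous fun z : ℂ => ((z.re.toNNReal ^ t : NNReal) : ℂ) :=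
    Complex.continuous_ofReal.comp (NNReal.continuous_coe.comp ((NNReal.continuous_rpow_const ht).comp
      (continuous_real_toNNReal.comp Complex.continuous_re)))
  have c1 := hc (t := max θ 1 - 1) (sub_nonneg.mpr (le_max_right _ _))
  have c2 := hc (t := max θ 1 - θ) (sub_nonneg.mpr (le_max_left _ _))
  have c3 := hc (t := max θ 1) (zero_le_one.trans (le_max_right _ _))
  have hn : IsStarNormal A.inv := (IsSelfAdjoint.of_nonneg A.inv_nonneg).isStarNormal
  rw [pencil, inv_rpow_eq_cfc, inv_rpow_eq_cfc, inv_rpow_eq_cfc,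
    ← cfc_const_mul ξ _ A.inv c2.continuousOn, ← cfc_const_mul (ξ ^ 2) _ A.inv c3.continuousOn,
    ← cfc_add A.inv _ _ c1.continuousOn (c2.const_mul ξ).continuousOn,
    ← cfc_add A.inv (fun z : ℂ => ((z.re.toNNReal ^ (max θ 1 - 1) : NNReal) : ℂ) +
        ξ * ((z.re.toNNReal ^ (max θ 1 - θ) : NNReal) : ℂ)) _
      (c1.add (c2.const_mul ξ)).continuousOn (c3.const_mul (ξ ^ 2)).continuousOn,
    isUnit_cfc_iff (fun z : ℂ => ((z.re.toNNReal ^ (max θ 1 - 1) : NNReal) : ℂ) +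
        ξ * ((z.re.toNNReal ^ (max θ 1 - θ) : NNReal) : ℂ) +
        ξ ^ 2 * ((z.re.toNNReal ^ max θ 1 : NNReal) : ℂ)) A.inv
      ((c1.add (c2.const_mul ξ)).add (c3.const_mul (ξ ^ 2))).continuousOn hn]
  constructor
  · intro h x hx hxs
    have := h x hxs
    simpa [hx] using this
  · intro h z hz
    obtain ⟨e, h0⟩ := A.eq_re_of_mem_spectrum hz
    have := h z.re h0 (e ▸ hz)
    simpa [h0] using this

theorem isUnit_inv_iff : IsUnit A.inv ↔ IsBoundedOperator A.op := by
  constructor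
  · intro h
    have hs := (ContinuousLinearMap.isUnit_iff_bijective.mp h).2
    obtain ⟨U, hU⟩ := h
    refine ⟨Submodule.eq_top_iff'.mpr fun x => ?_, ‖(↑U⁻¹ : H →L[ℂ] H)‖, fun x => ?_⟩
    · obtain ⟨y, rfl⟩ := hs x
      exact A.inv_mem y
    · have e : (↑U⁻¹ : H →L[ℂ] H) (x : H) = A.op x := by
        rw [← A.inv_op x, ← hU]
        exact congrArg (fun T : H →L[ℂ] H => T (A.op x)) U.inv_mul
      rw [← e]
      exact ContinuousLinearMap.le_opNorm _ _
  · rintro ⟨h, -⟩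
    refine ContinuousLinearMap.isUnit_iff_bijective.mpr ⟨A.inv_injective, fun x => ?_⟩
    exact ⟨_, A.inv_op ⟨x, h ▸ Submodule.mem_top⟩⟩

theorem zero_mem_spectrum_inv_iff :
    (0 : ℂ) ∈ _root_.spectrum ℂ A.inv ↔ ¬ IsBoundedOperator A.op := by
  rw [spectrum.zero_mem_iff, A.isUnit_inv_iff]

theorem generator_bijective_iff_le_one_or_bounded {θ : ℝ} :
    Function.Bijective (fun z : (A.generator θ).domain => A.generator θ z) ↔
      θ ≤ 1 ∨ IsBoundedOperator A.op := by
  rw [A.generator_bijective_iff, A.isUnit_pencil_iff]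
  simp only [zero_mul, add_zero, ne_eq, OfNat.ofNat_ne_zero, not_false_eq_true, zero_pow,
    Complex.ofReal_eq_zero]
  rcases le_or_gt θ 1 with h | h
  · simp [h]
  · rw [max_eq_left h.le, or_iff_right (not_le.mpr h), ← not_iff_not,
      ← A.zero_mem_spectrum_inv_iff]
    push Not
    constructor
    · rintro ⟨x, hx, hxs, e⟩
      rw [Real.rpow_eq_zero hx (sub_pos.mpr h).ne'] at e
      simpa [e] using hxs
    · exact fun h0 => ⟨0, le_rfl, by simpa using h0, Real.zero_rpow (sub_pos.mpr h).ne'⟩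

theorem mem_resolventSet_op_iff {ξ : ℂ} (hξ : ξ ≠ 0) :
    ξ ∈ resolventSet A.op ↔ ξ⁻¹ ∉ _root_.spectrum ℂ A.inv := by
  rw [spectrum.notMem_iff]
  set D : H →L[ℂ] H := algebraMap ℂ (H →L[ℂ] H) ξ⁻¹ - A.inv with hD
  have e (y : H) : ξ • A.inv y - y = (-ξ) • D y := by
    have : D y = ξ⁻¹ • y - A.inv y := by
      rw [hD, Algebra.algebraMap_eq_smul_one]
      rfl
    rw [this, smul_sub, smul_smul, neg_mul, mul_inv_cancel₀ hξ]
    module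
  have hξ' : -ξ ≠ 0 := neg_ne_zero.mpr hξ
  constructor
  · intro h
    have hb := bijective_of_mem_resolventSet h
    refine ContinuousLinearMap.isUnit_iff_bijective.mpr
      ⟨(injective_iff_map_eq_zero _).mpr fun y hy => ?_, fun z => ?_⟩
    · have h0 := @hb.1 ⟨A.inv y, A.inv_mem y⟩ 0 (by
        dsimp only
        rw [A.op_inv, e, hy]
        simp)
      exact A.inv_injective ((congrArg Subtype.val h0).trans (map_zero A.inv).symm)
    · obtain ⟨x, hx⟩ := hb.2 ((-ξ) • z)
      refine ⟨A.op x, smul_right_injective H hξ' ?_⟩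
      dsimp only at hx ⊢
      rw [← e, A.inv_op, hx]
  · rintro ⟨U, hU⟩
    have hl (x : H) : (↑U⁻¹ : H →L[ℂ] H) (D x) = x := by
      rw [← hU]; exact congrArg (fun T : H →L[ℂ] H => T x) U.inv_mul
    have hr (x : H) : D ((↑U⁻¹ : H →L[ℂ] H) x) = x := by
      rw [← hU]; exact congrArg (fun T : H →L[ℂ] H => T x) U.mul_inv
    refine ⟨A.inv ∘L ((-ξ)⁻¹ • (↑U⁻¹ : H →L[ℂ] H)), fun y => ⟨A.inv_mem _, ?_⟩, fun x => ?_⟩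
    · refine (congrArg _ (A.op_inv _)).trans ((e _).trans ?_)
      change (-ξ) • D ((-ξ)⁻¹ • (↑U⁻¹ : H →L[ℂ] H) y) = y
      rw [map_smul, hr, smul_smul, mul_inv_cancel₀ hξ', one_smul]
    · rw [← A.inv_op x, e, ContinuousLinearMap.comp_apply, smul_apply,
        map_smul (↑U⁻¹ : H →L[ℂ] H), hl, smul_smul, inv_mul_cancel₀ hξ', one_smul]

theorem mem_spectrum_op_iff {s : ℝ} :
    (s : ℂ) ∈ spectrum A.op ↔ 0 < s ∧ ((s⁻¹ : ℝ) : ℂ) ∈ _root_.spectrum ℂ A.inv := by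
  rcases eq_or_ne s 0 with rfl | h0
  · simp only [lt_irrefl, false_and, iff_false, spectrum, Set.mem_compl_iff, not_not]
    refine ⟨-A.inv, fun y => ⟨A.op.domain.neg_mem (A.inv_mem y), ?_⟩, fun x => ?_⟩
    · have : (⟨(-A.inv) y, A.op.domain.neg_mem (A.inv_mem y)⟩ : A.op.domain) =
        -⟨A.inv y, A.inv_mem y⟩ := rfl
      rw [this, LinearPMap.map_neg, A.op_inv]
      simp
    · simp [A.inv_op]
  · rw [spectrum, Set.mem_compl_iff, A.mem_resolventSet_op_iff (Complex.ofReal_ne_zero.mpr h0), not_not,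
      ← Complex.ofReal_inv]
    refine ⟨fun h => ⟨?_, h⟩, fun h => h.2⟩
    have := (A.eq_re_of_mem_spectrum h).2
    rw [Complex.ofReal_re] at this
    exact lt_of_le_of_ne (_root_.inv_nonneg.mp this) h0.symm

end StrictlyPositiveOperator

/-! ### The characteristic roots -/

theorem two_le_rpow_iff {θ s : ℝ} (hs : 0 < s) :
    2 ≤ s ^ (θ - 1 / 2) ↔ 4 * s ≤ s ^ (2 * θ) := by
  have e : s ^ (2 * θ) = (s ^ (θ - 1 / 2)) ^ 2 * s := by
    rw [← Real.rpow_natCast, ← Real.rpow_mul hs.le, ← Real.rpow_add_one hs.ne']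
    congr 1
    push_cast
    ring
  have h0 : 0 < s ^ (θ - 1 / 2) := Real.rpow_pos_of_pos hs _
  rw [e, mul_le_mul_iff_left₀ hs]
  constructor <;> intro h <;> nlinarith

theorem eq_xi_iff {θ s : ℝ} (hs : 0 < s) (ξ : ℂ) :
    ξ = xiPlus θ s ∨ ξ = xiMinus θ s ↔ (s : ℂ) + ξ * (s ^ θ : ℝ) + ξ ^ 2 = 0 := by
  have e : s ^ (2 * θ) = (s ^ θ) ^ 2 := by
    rw [mul_comm, Real.rpow_mul hs.le, Real.rpow_two]
  have key (r : ℂ) (hr : r ^ 2 = ((s ^ θ : ℝ) : ℂ) ^ 2 - 4 * s) :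
      (s : ℂ) + ξ * (s ^ θ : ℝ) + ξ ^ 2 =
        (ξ - (-((s ^ θ : ℝ) : ℂ) / 2 + r / 2)) * (ξ - (-((s ^ θ : ℝ) : ℂ) / 2 - r / 2)) := by
    linear_combination (1 / 4 : ℂ) * hr
  unfold xiPlus xiMinus
  split_ifs with h
  · rw [two_le_rpow_iff hs] at h
    rw [key (√(s ^ (2 * θ) - 4 * s) : ℝ), mul_eq_zero, sub_eq_zero, sub_eq_zero]
    · push_cast
      simp only [neg_div]
    · rw [← Complex.ofReal_pow, Real.sq_sqrt (sub_nonneg.mpr h), e]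
      push_cast
      ring
  · rw [two_le_rpow_iff hs, not_le] at h
    rw [key (Complex.I * (√(4 * s - s ^ (2 * θ)) : ℝ)), mul_eq_zero, sub_eq_zero, sub_eq_zero]
    · push_cast
      simp only [neg_div, mul_div_assoc]
    · rw [mul_pow, Complex.I_sq, ← Complex.ofReal_pow, Real.sq_sqrt (sub_nonneg.mpr h.le), e]
      push_cast
      ring

theorem pencil_symbol_eq_zero_iff {θ x : ℝ} (hx : 0 < x) (ξ : ℂ) :
    ((x ^ (max θ 1 - 1) : ℝ) : ℂ) + ξ * (x ^ (max θ 1 - θ) : ℝ) + ξ ^ 2 * (x ^ max θ 1 : ℝ) = 0 ↔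
      ξ = xiPlus θ x⁻¹ ∨ ξ = xiMinus θ x⁻¹ := by
  rw [eq_xi_iff (inv_pos.mpr hx), Real.rpow_sub hx, Real.rpow_sub hx, Real.rpow_one,
    Real.inv_rpow hx.le]
  have h : ((x ^ max θ 1 : ℝ) : ℂ) ≠ 0 := Complex.ofReal_ne_zero.mpr (Real.rpow_pos_of_pos hx _).ne'
  refine Iff.trans (Eq.congr_left ?_) (mul_eq_zero_iff_left h)
  push_cast
  ring

theorem pencil_symbol_zero_eq_zero_iff {θ : ℝ} {ξ : ℂ} (hξ : ξ ≠ 0) :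
    (((0 : ℝ) ^ (max θ 1 - 1) : ℝ) : ℂ) + ξ * ((0 : ℝ) ^ (max θ 1 - θ) : ℝ) +
      ξ ^ 2 * ((0 : ℝ) ^ max θ 1 : ℝ) = 0 ↔ θ = 1 ∧ ξ = -1 := by
  rcases lt_trichotomy θ 1 with h | rfl | h
  · simp [max_eq_right h.le, Real.zero_rpow (sub_pos.mpr h).ne', h.ne]
  · simp [add_comm, add_eq_zero_iff_eq_neg]
  · simp [max_eq_left h.le, Real.zero_rpow (sub_pos.mpr h).ne', h.ne', hξ,
      Real.zero_rpow (zero_lt_one.trans h).ne']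

theorem xi_ne_zero {θ s : ℝ} (hs : 0 < s) {ξ : ℂ} (h : ξ = xiPlus θ s ∨ ξ = xiMinus θ s) :
    ξ ≠ 0 := by
  rintro rfl
  simpa [hs.ne'] using (eq_xi_iff hs 0).mp h

namespace StrictlyPositiveOperator

variable {H : Type*} [NormedAddCommGroup H] [InnerProductSpace ℂ H] [CompleteSpace H]
  (A : StrictlyPositiveOperator H)

theorem mem_spectrum_generator_iff {θ : ℝ} {ξ : ℂ} :
    ξ ∈ spectrum (A.generator θ) \ {0} ↔
      (∃ s : ℝ, (s : ℂ) ∈ spectrum A.op ∧ (ξ = xiPlus θ s ∨ ξ = xiMinus θ s)) ∨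
        (θ = 1 ∧ ¬ IsBoundedOperator A.op) ∧ ξ = -1 := by
  have h1 : ξ ∈ spectrum (A.generator θ) ↔ ∃ x : ℝ, 0 ≤ x ∧ (x : ℂ) ∈ _root_.spectrum ℂ A.inv ∧
      ((x ^ (max θ 1 - 1) : ℝ) : ℂ) + ξ * (x ^ (max θ 1 - θ) : ℝ) + ξ ^ 2 * (x ^ max θ 1 : ℝ)
        = 0 := by
    rw [spectrum, Set.mem_compl_iff, A.mem_resolventSet_generator_iff, A.isUnit_pencil_iff]
    push Not
    rfl
  rw [Set.mem_sdiff, Set.mem_singleton_iff, h1, ← A.zero_mem_spectrum_inv_iff]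
  simp only [A.mem_spectrum_op_iff]
  constructor
  · rintro ⟨⟨x, hx, hxs, e⟩, hξ⟩
    rcases hx.eq_or_lt with rfl | hx
    · obtain ⟨h1, h2⟩ := (pencil_symbol_zero_eq_zero_iff hξ).mp e
      exact Or.inr ⟨⟨h1, by simpa using hxs⟩, h2⟩
    · exact Or.inl ⟨x⁻¹, ⟨inv_pos.mpr hx, by rwa [inv_inv]⟩, (pencil_symbol_eq_zero_iff hx ξ).mp e⟩
  · rintro (⟨s, ⟨hs, hss⟩, e⟩ | ⟨⟨h1, h0⟩, h2⟩)
    · refine ⟨⟨s⁻¹, (inv_pos.mpr hs).le, hss, ?_⟩, xi_ne_zero hs e⟩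
      rw [pencil_symbol_eq_zero_iff (inv_pos.mpr hs), inv_inv]
      exact e
    · have hξ : ξ ≠ 0 := by rw [h2]; simp
      exact ⟨⟨0, le_rfl, by simpa using h0, (pencil_symbol_zero_eq_zero_iff hξ).mpr ⟨h1, h2⟩⟩, hξ⟩

end StrictlyPositiveOperator

end DampedWave

end

theorem mainTheorem11 {H : Type*} [NormedAddCommGroup H] [InnerProductSpace ℂ H] [CompleteSpace H]
    (A : DampedWave.StrictlyPositiveOperator H) (θ : ℝ) :
    (Function.Bijective (fun z : (A.generator θ).domain => A.generator θ z) ↔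
      θ ≤ 1 ∨ DampedWave.IsBoundedOperator A.op) ∧
    (θ = 1 ∧ ¬ DampedWave.IsBoundedOperator A.op →
      DampedWave.spectrum (A.generator θ) \ {0} =
        (⋃ s ∈ {s : ℝ | (s : ℂ) ∈ DampedWave.spectrum A.op},
          {DampedWave.xiPlus θ s, DampedWave.xiMinus θ s}) ∪ {-1}) ∧
    (¬ (θ = 1 ∧ ¬ DampedWave.IsBoundedOperator A.op) →
      DampedWave.spectrum (A.generator θ) \ {0} =
        ⋃ s ∈ {s : ℝ | (s : ℂ) ∈ DampedWave.spectrum A.op},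
          {DampedWave.xiPlus θ s, DampedWave.xiMinus θ s}) := by
  refine ⟨A.generator_bijective_iff_le_one_or_bounded, fun h => ?_, fun h => ?_⟩ <;> ext ξ <;>
    rw [A.mem_spectrum_generator_iff] <;>
    simp only [h, true_and, false_and, or_false, Set.mem_union, Set.mem_iUnion, Set.mem_ofPred_eq,
      Set.mem_insert_iff, Set.mem_singleton_iff, exists_prop]
  · simp
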